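/- For integers $r\ge 2$ and $s,n,k\ge 0$, the generalized Kneser hypergraph $K^r_s(n,k)$ is the $r$-uniform hypergraph whose vertices are the $k$-element subsets of $[n]=\{1,\dots,n\}$, and in which $r$ distinct vertices $F_1,\dots,F_r$ form an edge if and only if no element of $[n]$ is contained in more than $s$ of them. The chromatic number $\chi(H)$ of a hypergraph $H$ is the least integer $m$ for which there is a map from the vertex set of $H$ to $\{1,\dots,m\}$ that is not constant on any edge of $H$. Theorem. Let $c>0$ be a real number and let $r\ge 2$ and $t\ge 0$ be integers. Then there exists an integer $K_0=K_0(c,r,t)\ge 0$ such that, if $k\ge K_0$ is an integer, $s=r-1$, and $n=\left(\frac{r}{s}+c\right)k$, rounded down or up to an integer (that is, $n=\left\lfloor\left(\frac{r}{s}+c\right)k\right\rfloor$ or $n=\left\lceil\left(\frac{r}{s}+c\right)k\right\rceil$), then $\chi\left(K^r_s(n,k)\right)>t$. -/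

import Mathlib

namespace Hypergraph

/-- `H` is `m`-colorable: there is a map from the vertices of `H` to an `m`-element set of colors
such that every edge contains two vertices of different colors. -/
def Colorable {α : Type*} (H : Hypergraph α) (m : ℕ) : Prop :=
  ∃ f : H.vertexSet → Fin m, ∀ e ∈ H.edgeSet,
    ∃ u v : H.vertexSet, (u : α) ∈ e ∧ (v : α) ∈ e ∧ f u ≠ f v

/-- The chromatic number of `H`: the least `m` such that `H` is `m`-colorable
(`⊤` if there is no such `m`). -/
noncomputable def chromaticNumber {α : Type*} (H : Hypergraph α) : ℕ∞ :=
  ⨅ (m : ℕ) (_ : H.Colorable m), (m : ℕ∞)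

/-- The generalized Kneser hypergraph `K^r_s(n, k)`. Its vertices are the `k`-element subsets of an
`n`-element set, and its edges are the sets of exactly `r` (distinct) vertices such that no element
of the ground set lies in more than `s` of them. -/
def generalizedKneser (r s n k : ℕ) : Hypergraph (Finset (Fin n)) where
  vertexSet := {F | F.card = k}
  edgeSet := {e | e ⊆ {F | F.card = k} ∧ e.encard = r ∧
    ∀ x : Fin n, {F | F ∈ e ∧ x ∈ F}.encard ≤ s}
  subset_vertexSet_of_mem_edgeSet' := fun _ he => he.1

end Hypergraph

/-! For `s = r - 1` an edge is a set of `r` distinct `k`-sets with no common element. Suppose `t`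
colour classes cover all `k`-sets and none contains an edge. Then no partition of the ground set
into `r` parts has the complement of every part in the up-closure of one class with at least `r`
members. Averaging over a uniform random partition bounds the `(1 - 1/r)`-biased measure of that
up-closure by `1 - 1/r` (`mean_upIndicator_le`).

As `n / k` is close to `D > r / (r - 1)`, there is room for a bias `p₀ < 1 - 1/r` with `n * p₀`
exceeding `k` by a linear amount. Between `p₀` and `1 - 1/r` the sum of the measures is driven below
`1/2`: where it falls slowly with the bias, the total influence is bounded by Russo's formula, and a
Kahn–Kalai–Linial argument supplies an influential coordinate; setting it to `false` lowers the sum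
by a fixed amount (`exists_restrict_sum_mean_lt`). This deletes boundedly many points; boundedly
many more meet every set of the classes with fewer than `r` members.

But a random set at such a bias has, with probability at least `1/2`, enough points to contain a
`k`-set avoiding all deleted points. That set has a colour, so the sum of the measures is at least
`1/2`, a contradiction. -/

namespace BiasedCube

/-! ### Expectation on the biased cube and its splitting along the first coordinate. -/

/-- The mean of `f` on the cube when every coordinate is `true` with probability `p`,
independently. -/
def mean (p : ℝ) : {n : ℕ} → ((Fin n → Bool) → ℝ) → ℝ
  | 0, f => f Fin.elim0
  | _ + 1, f => p * mean p (fun x => f (Fin.cons true x)) +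
      (1 - p) * mean p (fun x => f (Fin.cons false x))

/-- The average of `f` over the first coordinate. -/
def headMean (p : ℝ) {n : ℕ} (f : (Fin (n + 1) → Bool) → ℝ) (x : Fin n → Bool) : ℝ :=
  p * f (Fin.cons true x) + (1 - p) * f (Fin.cons false x)

/-- The discrete derivative of `f` in the coordinate `j`. -/
def diff {n : ℕ} (j : Fin n) (f : (Fin n → Bool) → ℝ) (x : Fin n → Bool) : ℝ :=
  f (Function.update x j true) - f (Function.update x j false)

/-- The discrete derivative of `f` in the first coordinate, as a function of the others. -/
def headDiff {n : ℕ} (f : (Fin (n + 1) → Bool) → ℝ) (x : Fin n → Bool) : ℝ :=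
  f (Fin.cons true x) - f (Fin.cons false x)

variable {n : ℕ} {p : ℝ}

theorem mean_add (f g : (Fin n → Bool) → ℝ) :
    mean p (fun x => f x + g x) = mean p f + mean p g := by
  induction n with
  | zero => rfl
  | succ n ih => simp only [mean, ih]; ring

theorem mean_const_mul (a : ℝ) (f : (Fin n → Bool) → ℝ) :
    mean p (fun x => a * f x) = a * mean p f := by
  induction n with
  | zero => rfl
  | succ n ih => simp only [mean, ih]; ring

theorem mean_const (a : ℝ) : mean p (fun _ : Fin n → Bool => a) = a := by
  induction n with
  | zero => rfl
  | succ n ih => simp only [mean, ih]; ring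

theorem mean_sub (f g : (Fin n → Bool) → ℝ) :
    mean p (fun x => f x - g x) = mean p f - mean p g := by
  induction n with
  | zero => rfl
  | succ n ih => simp only [mean, ih]; ring

theorem mean_sum {ι : Type*} (s : Finset ι) (f : ι → (Fin n → Bool) → ℝ) :
    mean p (fun x => ∑ i ∈ s, f i x) = ∑ i ∈ s, mean p (f i) := by
  induction n with
  | zero => rfl
  | succ n ih => simp only [mean, ih, Finset.sum_add_distrib, Finset.mul_sum]

theorem mean_le_mean (h0 : 0 ≤ p) (h1 : p ≤ 1) {f g : (Fin n → Bool) → ℝ} (h : ∀ x, f x ≤ g x) :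
    mean p f ≤ mean p g := by
  induction n with
  | zero => exact h _
  | succ n ih =>
    have h1' : 0 ≤ 1 - p := by linarith
    have a := ih (fun x => h (Fin.cons true x))
    have b := ih (fun x => h (Fin.cons false x))
    simp only [mean]
    gcongr

theorem mean_nonneg (h0 : 0 ≤ p) (h1 : p ≤ 1) {f : (Fin n → Bool) → ℝ} (h : ∀ x, 0 ≤ f x) :
    0 ≤ mean p f := by
  simpa only [mean_const] using mean_le_mean h0 h1 (f := fun _ => 0) h

theorem mean_succ (f : (Fin (n + 1) → Bool) → ℝ) : mean p f = mean p (headMean p f) := by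
  unfold headMean
  rw [mean_add, mean_const_mul, mean_const_mul]; rfl

theorem mean_mul_sq_le (h0 : 0 ≤ p) (h1 : p ≤ 1) (f g : (Fin n → Bool) → ℝ) :
    mean p (fun x => f x * g x) ^ 2 ≤ mean p (fun x => f x ^ 2) * mean p (fun x => g x ^ 2) := by
  have h : ∀ s : ℝ, 0 ≤ mean p (fun x => f x ^ 2) * (s * s) + 2 * mean p (fun x => f x * g x) * s
      + mean p (fun x => g x ^ 2) := by
    intro s
    have := mean_nonneg h0 h1 (f := fun x => (s * f x + g x) ^ 2) (fun x => sq_nonneg _)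
    have e : (fun x => (s * f x + g x) ^ 2) =
        fun x => (s * s) * f x ^ 2 + (2 * s * (f x * g x) + g x ^ 2) := by
      funext x; ring
    rw [e, mean_add, mean_add, mean_const_mul, mean_const_mul] at this
    linarith
  have := discrim_le_zero h
  rw [discrim] at this
  linarith

theorem apply_cons (f : (Fin (n + 1) → Bool) → ℝ) (p : ℝ) (b : Bool) (x : Fin n → Bool) :
    f (Fin.cons b x) = headMean p f x + ((if b then 1 else 0) - p) * headDiff f x := by
  cases b <;> simp [headMean, headDiff] <;> ring

theorem diff_zero_cons (f : (Fin (n + 1) → Bool) → ℝ) (b : Bool) (x : Fin n → Bool) :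
    diff 0 f (Fin.cons b x) = headDiff f x := by
  simp [diff, headDiff, Fin.update_cons_zero]

theorem diff_succ_cons (f : (Fin (n + 1) → Bool) → ℝ) (j : Fin n) (b : Bool) (x : Fin n → Bool) :
    diff j.succ f (Fin.cons b x) = diff j (fun y => f (Fin.cons b y)) x := by
  simp [diff, Fin.cons_update]

/-- The energy of `f`: the sum of the second moments of its discrete derivatives. -/
def energy (p : ℝ) (f : (Fin n → Bool) → ℝ) : ℝ := ∑ j, mean p (fun x => diff j f x ^ 2)

theorem diff_headMean (f : (Fin (n + 1) → Bool) → ℝ) (j : Fin n) :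
    diff j (headMean p f) = headMean p (diff j.succ f) := by
  funext x
  simp only [headMean, diff_succ_cons]
  simp only [diff, headMean]; ring

theorem diff_headDiff (f : (Fin (n + 1) → Bool) → ℝ) (j : Fin n) :
    diff j (headDiff f) = headDiff (diff j.succ f) := by
  funext x
  simp only [headDiff, diff_succ_cons]
  simp only [diff, headDiff]; ring

/-- Parseval in one coordinate: by `apply_cons`, `f` is `headMean` plus a centred coordinate of
variance `p * (1 - p)` times `headDiff`. Iterating gives the expansion in products of centred
coordinates. -/
theorem mean_sq_succ (f : (Fin (n + 1) → Bool) → ℝ) : mean p (fun x => f x ^ 2) =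
    mean p (fun x => headMean p f x ^ 2) + p * (1 - p) * mean p (fun x => headDiff f x ^ 2) := by
  rw [mean_succ, ← mean_const_mul, ← mean_add]
  congr 1; funext x
  simp only [headMean, headDiff]; ring

theorem mean_headDiff_sq (f : (Fin (n + 1) → Bool) → ℝ) :
    mean p (fun x => diff 0 f x ^ 2) = mean p (fun x => headDiff f x ^ 2) := by
  rw [mean_succ]
  congr 1; funext x
  simp only [headMean, diff_zero_cons]; ring

theorem energy_succ (f : (Fin (n + 1) → Bool) → ℝ) : energy p f =
    energy p (headMean p f) + p * (1 - p) * energy p (headDiff f) +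
      mean p (fun x => headDiff f x ^ 2) := by
  unfold energy
  rw [Fin.sum_univ_succ, mean_headDiff_sq, Finset.mul_sum, ← Finset.sum_add_distrib, add_comm]
  congr 1
  refine Finset.sum_congr rfl fun j _ => ?_
  rw [diff_headMean, diff_headDiff, mean_sq_succ]

/-! ### The noise operator and hypercontractivity. -/

/-- The noise operator which multiplies a product of `m` centred coordinates by `κ ^ m`. -/
def noise (p κ : ℝ) : {n : ℕ} → ((Fin n → Bool) → ℝ) → (Fin n → Bool) → ℝ
  | 0, f => f
  | _ + 1, f => fun x => noise p κ (headMean p f) (Fin.tail x) +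
      κ * ((if x 0 then 1 else 0) - p) * noise p κ (headDiff f) (Fin.tail x)

theorem noise_cons (κ : ℝ) (f : (Fin (n + 1) → Bool) → ℝ) (b : Bool) (x : Fin n → Bool) :
    noise p κ f (Fin.cons b x) = noise p κ (headMean p f) x +
      κ * ((if b then 1 else 0) - p) * noise p κ (headDiff f) x := rfl

/-- The quadratic form of the noise operator. -/
def noiseForm (p κ : ℝ) : {n : ℕ} → ((Fin n → Bool) → ℝ) → ℝ
  | 0, f => f Fin.elim0 ^ 2
  | _ + 1, f => noiseForm p κ (headMean p f) + κ * (p * (1 - p)) * noiseForm p κ (headDiff f)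

theorem mean_mul_noise (κ : ℝ) (f : (Fin n → Bool) → ℝ) :
    mean p (fun x => f x * noise p κ f x) = noiseForm p κ f := by
  induction n with
  | zero => simp [mean, noise, noiseForm, sq]
  | succ n ih =>
    rw [noiseForm, ← ih, ← ih, mean_succ, ← mean_const_mul, ← mean_add]
    congr 1; funext x
    have ht := apply_cons f p true x
    have hf := apply_cons f p false x
    rw [headMean, noise_cons, noise_cons, ht, hf]
    simp only [if_true, Bool.false_eq_true, if_false]
    ring

theorem noiseForm_nonneg (h0 : 0 ≤ p) (h1 : p ≤ 1) {κ : ℝ} (hκ : 0 ≤ κ) (f : (Fin n → Bool) → ℝ) :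
    0 ≤ noiseForm p κ f := by
  induction n with
  | zero => exact sq_nonneg _
  | succ n ih =>
    have := ih (headMean p f)
    have := ih (headDiff f)
    have : 0 ≤ 1 - p := by linarith
    rw [noiseForm]
    positivity

/-- With `v = p * (1 - p)`, the centred coordinate has moments `0`, `v`, `v * (1 - 2 * p)`, `v * (1
- 3 * v)`. The cubic term has no sign and is split by AM-GM between the `A ^ 2 * B ^ 2` and `B ^ 4`
terms; `3 * κ ≤ v` leaves room for both. -/
theorem two_point_fourth_moment_le (h0 : 0 ≤ p) (h1 : p ≤ 1) {κ : ℝ} (hκ : 0 ≤ κ)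
    (hκp : 3 * κ ≤ p * (1 - p)) (A B : ℝ) :
    p * (A + κ * (1 - p) * B) ^ 4 + (1 - p) * (A + κ * (0 - p) * B) ^ 4 ≤
      A ^ 4 + 2 * (κ * (p * (1 - p))) * (A ^ 2 * B ^ 2) + (κ * (p * (1 - p))) ^ 2 * B ^ 4 := by
  obtain ⟨v, hv⟩ : ∃ v, v = p * (1 - p) := ⟨_, rfl⟩
  have hv0 : 0 ≤ v := by rw [hv]; exact mul_nonneg h0 (by linarith)
  have hv4 : v ≤ 1 / 4 := by rw [hv]; nlinarith [sq_nonneg (p - 1 / 2)]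
  have e : p * (A + κ * (1 - p) * B) ^ 4 + (1 - p) * (A + κ * (0 - p) * B) ^ 4 =
      A ^ 4 + 6 * κ ^ 2 * v * (A ^ 2 * B ^ 2) + 4 * κ ^ 3 * v * ((1 - 2 * p) * (A * B ^ 3)) +
        κ ^ 4 * v * (1 - 3 * v) * B ^ 4 := by rw [hv]; ring
  have h3 : (1 - 2 * p) * (A * B ^ 3) ≤ (A ^ 2 * B ^ 2 + B ^ 4) / 2 := by
    have h : ((1 - 2 * p) * A) * B ≤ (((1 - 2 * p) * A) ^ 2 + B ^ 2) / 2 := by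
      nlinarith [sq_nonneg ((1 - 2 * p) * A - B)]
    have h' : ((1 - 2 * p) * A) ^ 2 ≤ A ^ 2 := by
      rw [mul_pow]
      have : (1 - 2 * p) ^ 2 ≤ 1 := by nlinarith
      nlinarith [sq_nonneg A]
    nlinarith [sq_nonneg B]
  have hκ1 : κ ≤ 1 / 12 := by linarith
  rw [← hv] at hκp ⊢
  rw [e]
  have c1 : 6 * κ ^ 2 * v + 2 * κ ^ 3 * v ≤ 2 * (κ * v) := by
    have : 0 ≤ κ * v * (2 - 6 * κ - 2 * κ ^ 2) :=
      mul_nonneg (mul_nonneg hκ hv0) (by nlinarith)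
    linarith
  have c2 : 2 * κ ^ 3 * v + κ ^ 4 * v * (1 - 3 * v) ≤ (κ * v) ^ 2 := by
    have h1 : 0 ≤ κ ^ 2 * v * (v - 2 * κ - κ ^ 2) :=
      mul_nonneg (mul_nonneg (sq_nonneg _) hv0) (by nlinarith)
    have h2 : 0 ≤ κ ^ 4 * v * (3 * v) := by positivity
    linarith
  have d1 := mul_le_mul_of_nonneg_right c1 (mul_nonneg (sq_nonneg A) (sq_nonneg B))
  have d2 := mul_le_mul_of_nonneg_right c2 (show 0 ≤ B ^ 4 by positivity)
  have d3 := mul_le_mul_of_nonneg_left h3 (show 0 ≤ 4 * κ ^ 3 * v by positivity)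
  linarith

/-- Hypercontractivity of the noise operator. -/
theorem mean_noise_pow_four_le (h0 : 0 ≤ p) (h1 : p ≤ 1) {κ : ℝ} (hκ : 0 ≤ κ)
    (hκp : 3 * κ ≤ p * (1 - p)) (f : (Fin n → Bool) → ℝ) :
    mean p (fun x => noise p κ f x ^ 4) ≤ noiseForm p κ f ^ 2 := by
  induction n with
  | zero => simp only [mean, noise, noiseForm]; exact le_of_eq (by ring)
  | succ n ih =>
    set A := noise p κ (headMean p f) with hA
    set B := noise p κ (headDiff f) with hB
    have hA4 := ih (headMean p f)
    have hB4 := ih (headDiff f)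
    have hQA := noiseForm_nonneg h0 h1 hκ (headMean p f)
    have hQB := noiseForm_nonneg h0 h1 hκ (headDiff f)
    rw [← hA] at hA4
    rw [← hB] at hB4
    set a := noiseForm p κ (headMean p f)
    set b := noiseForm p κ (headDiff f)
    have hv0 : 0 ≤ κ * (p * (1 - p)) := mul_nonneg hκ (mul_nonneg h0 (by linarith))
    -- Cauchy–Schwarz bounds the mixed term, so that the two-point bound averages to `(a + κ * (p *
    -- (1 - p)) * b) ^ 2`.
    have hAB : mean p (fun x => A x ^ 2 * B x ^ 2) ≤ a * b := by
      refine abs_le_of_sq_le_sq' ?_ (mul_nonneg hQA hQB) |>.2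
      refine (mean_mul_sq_le h0 h1 _ _).trans ?_
      simp only [← pow_mul, Nat.reduceMul]
      rw [mul_pow]
      refine mul_le_mul hA4 hB4 (mean_nonneg h0 h1 fun x => by positivity) (by positivity)
    rw [mean_succ]
    refine (mean_le_mean h0 h1 (g := fun x => (A x ^ 4 + 2 * (κ * (p * (1 - p))) *
      (A x ^ 2 * B x ^ 2)) + (κ * (p * (1 - p))) ^ 2 * B x ^ 4) fun x => ?_).trans ?_
    · have := two_point_fourth_moment_le h0 h1 hκ hκp (A x) (B x)
      simpa [headMean, noise, Fin.tail_cons, Fin.cons_zero, ← hA, ← hB] using this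
    · rw [mean_add, mean_add, mean_const_mul, mean_const_mul, noiseForm]
      have d1 := mul_le_mul_of_nonneg_left hAB (show 0 ≤ 2 * (κ * (p * (1 - p))) by positivity)
      have d2 := mul_le_mul_of_nonneg_left hB4 (sq_nonneg (κ * (p * (1 - p))))
      nlinarith

/-- Duality: Cauchy–Schwarz on `f * g` with weight `|f|` gives `Q ^ 2 ≤ M * R`; a second use with
the fourth-moment bound gives `R ^ 2 ≤ S * Q ^ 2`. Eliminate `R` and cancel `Q ^ 2`. -/
theorem noiseForm_sq_le (h0 : 0 ≤ p) (h1 : p ≤ 1) {κ : ℝ} (hκ : 0 ≤ κ)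
    (hκp : 3 * κ ≤ p * (1 - p)) (f : (Fin n → Bool) → ℝ) :
    noiseForm p κ f ^ 2 ≤ mean p (fun x => |f x|) ^ 2 * mean p (fun x => f x ^ 2) := by
  set Q := noiseForm p κ f with hQ
  set M := mean p (fun x => |f x|) with hM
  set S := mean p (fun x => f x ^ 2) with hS
  set g := noise p κ f with hg
  set R := mean p (fun x => |f x| * g x ^ 2) with hR
  have hQ0 : 0 ≤ Q := noiseForm_nonneg h0 h1 hκ f
  have hM0 : 0 ≤ M := mean_nonneg h0 h1 fun x => abs_nonneg _
  have hS0 : 0 ≤ S := mean_nonneg h0 h1 fun x => sq_nonneg _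
  have hR0 : 0 ≤ R := mean_nonneg h0 h1 fun x => by positivity
  have a1 : Q ^ 2 ≤ M * R := by
    have e : Q ≤ mean p (fun x => √|f x| * (√|f x| * |g x|)) := by
      rw [hQ, ← mean_mul_noise]
      refine mean_le_mean h0 h1 fun x => ?_
      rw [← mul_assoc, Real.mul_self_sqrt (abs_nonneg _), ← abs_mul]
      exact le_abs_self _
    calc Q ^ 2 ≤ mean p (fun x => √|f x| * (√|f x| * |g x|)) ^ 2 := by gcongr
      _ ≤ _ := mean_mul_sq_le h0 h1 _ _
      _ = M * R := by
        simp only [mul_pow, Real.sq_sqrt (abs_nonneg _), sq_abs, hM, hR]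
  have a2 : R ^ 2 ≤ S * Q ^ 2 := by
    refine (mean_mul_sq_le h0 h1 _ _).trans ?_
    simp only [sq_abs, ← pow_mul]
    exact mul_le_mul_of_nonneg_left (mean_noise_pow_four_le h0 h1 hκ hκp f) hS0
  rcases hQ0.eq_or_lt with h | h
  · rw [← h]; simp only [ne_eq, OfNat.ofNat_ne_zero, not_false_eq_true, zero_pow]; positivity
  · have a3 : (Q ^ 2) ^ 2 ≤ (M * R) ^ 2 := by gcongr
    have a4 : Q ^ 2 * Q ^ 2 ≤ (M ^ 2 * S) * Q ^ 2 := by nlinarith [sq_nonneg M]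
    exact le_of_mul_le_mul_right a4 (by positivity)

/-! ### From hypercontractivity to a variance inequality. -/

/-- On the degree-`d` part of `f`, `p * (1 - p) * energy` acts as the factor `d` and `noiseForm` as
`κ ^ d`. The claim is thus `m ≤ d + κ ^ d / κ ^ m`, clear for `d ≥ m` and otherwise due to `2 ^ (m -
d) ≥ m - d`. -/
theorem mul_mean_sq_le_energy_add_noiseForm (h0 : 0 ≤ p) (h1 : p ≤ 1) {κ : ℝ} (hκ : 0 < κ)
    (hκ1 : κ ≤ 1 / 2) (m : ℕ) (f : (Fin n → Bool) → ℝ) :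
    m * mean p (fun x => f x ^ 2) ≤
      p * (1 - p) * energy p f + (κ⁻¹) ^ m * noiseForm p κ f := by
  have h1' : 0 ≤ 1 - p := by linarith
  have hv0 : 0 ≤ p * (1 - p) := mul_nonneg h0 h1'
  induction n generalizing m with
  | zero =>
    simp only [mean, energy, noiseForm, Finset.univ_eq_empty, Finset.sum_empty, mul_zero, zero_add]
    refine mul_le_mul_of_nonneg_right ?_ (sq_nonneg _)
    have hm : (m : ℝ) ≤ (κ⁻¹) ^ m := by
      calc (m : ℝ) ≤ 2 ^ m := by exact_mod_cast (Nat.lt_two_pow_self).le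
        _ ≤ (κ⁻¹) ^ m := by
          gcongr
          rw [le_inv_comm₀ (by norm_num) hκ]; linarith
    exact hm
  | succ n ih =>
    have hE : 0 ≤ energy p f := Finset.sum_nonneg fun j _ => mean_nonneg h0 h1 fun x => sq_nonneg _
    rcases m with _ | m
    · have := noiseForm_nonneg h0 h1 hκ.le f
      simp only [Nat.cast_zero, zero_mul, pow_zero, one_mul]
      positivity
    · have ha := ih (m + 1) (headMean p f)
      have hb := mul_le_mul_of_nonneg_left (ih m (headDiff f)) hv0
      rw [mean_sq_succ, energy_succ, noiseForm]
      have e : (κ⁻¹) ^ (m + 1) * (κ * (p * (1 - p)) * noiseForm p κ (headDiff f)) =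
          p * (1 - p) * ((κ⁻¹) ^ m * noiseForm p κ (headDiff f)) := by
        rw [pow_succ]; field_simp
      rw [mul_add ((κ⁻¹) ^ (m + 1)), e]
      push_cast at ha ⊢
      linarith

/-- A super-Poincaré inequality. -/
theorem mul_mean_sq_le_energy_add_mean_abs_sq (h0 : 0 ≤ p) (h1 : p ≤ 1) {κ : ℝ} (hκ : 0 < κ)
    (hκp : 3 * κ ≤ p * (1 - p)) (m : ℕ) (f : (Fin n → Bool) → ℝ) :
    m * mean p (fun x => f x ^ 2) ≤ p * (1 - p) * energy p f +
      ((κ⁻¹) ^ (m + 1)) ^ 2 * mean p (fun x => |f x|) ^ 2 := by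
  have hv4 : p * (1 - p) ≤ 1 / 4 := by nlinarith [sq_nonneg (p - 1 / 2)]
  -- The spare unit in `m + 1` absorbs the `S` produced by AM-GM on `L * Q ≤ L * M * √S`.
  have h := mul_mean_sq_le_energy_add_noiseForm h0 h1 hκ (by linarith) (m + 1) f
  have hQ := noiseForm_sq_le h0 h1 hκ.le hκp f
  set L := (κ⁻¹) ^ (m + 1)
  set Q := noiseForm p κ f
  set M := mean p (fun x => |f x|)
  set S := mean p (fun x => f x ^ 2)
  have hS0 : 0 ≤ S := mean_nonneg h0 h1 fun x => sq_nonneg _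
  have h2 : (2 * (L * Q)) ^ 2 ≤ (L ^ 2 * M ^ 2 + S) ^ 2 := by
    have := mul_le_mul_of_nonneg_left hQ (sq_nonneg L)
    nlinarith [sq_nonneg (L ^ 2 * M ^ 2 - S)]
  have h3 := (abs_le_of_sq_le_sq' h2 (by positivity)).2
  have h4 : 0 ≤ L ^ 2 * M ^ 2 := by positivity
  push_cast at h
  linarith

/-- An inequality of Kahn–Kalai–Linial type. -/
theorem mul_variance_le (h0 : 0 ≤ p) (h1 : p ≤ 1) {κ : ℝ} (hκ : 0 < κ)
    (hκp : 3 * κ ≤ p * (1 - p)) (m : ℕ) (f : (Fin n → Bool) → ℝ) :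
    m * (mean p (fun x => f x ^ 2) - mean p f ^ 2) ≤ p * (1 - p) * (energy p f +
      ((κ⁻¹) ^ (m + 1)) ^ 2 * ∑ j, mean p (fun x => |diff j f x|) ^ 2) := by
  have hv0 : 0 ≤ p * (1 - p) := mul_nonneg h0 (by linarith)
  induction n with
  | zero => simp [mean, energy]
  | succ n ih =>
    have ha := ih (headMean p f)
    -- The variance gained by the first coordinate is the second moment of `headDiff`, whose energy
    -- already occurs in `energy_succ`.
    have hb := mul_le_mul_of_nonneg_left
      (mul_mean_sq_le_energy_add_mean_abs_sq h0 h1 hκ hκp m (headDiff f)) hv0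
    have e0 : mean p (fun x => |diff 0 f x|) = mean p (fun x => |headDiff f x|) := by
      rw [mean_succ]
      congr 1; funext x
      simp only [headMean, diff_zero_cons]; ring
    have es : ∑ j, mean p (fun x => |diff j (headMean p f) x|) ^ 2 ≤
        ∑ j : Fin n, mean p (fun x => |diff j.succ f x|) ^ 2 := by
      refine Finset.sum_le_sum fun j _ => ?_
      have : 0 ≤ mean p (fun x => |diff j (headMean p f) x|) :=
        mean_nonneg h0 h1 fun x => abs_nonneg _
      gcongr
      rw [mean_succ, diff_headMean]
      refine mean_le_mean h0 h1 fun x => ?_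
      refine (abs_add_le _ _).trans ?_
      rw [abs_mul, abs_mul, abs_of_nonneg h0, abs_of_nonneg (by linarith : 0 ≤ 1 - p)]
      rfl
    have es' := mul_le_mul_of_nonneg_left es
      (show 0 ≤ p * (1 - p) * ((κ⁻¹) ^ (m + 1)) ^ 2 by positivity)
    have hB := mul_nonneg hv0 (mean_nonneg h0 h1 fun x => sq_nonneg (headDiff f x))
    rw [mean_sq_succ, energy_succ, mean_succ f, Fin.sum_univ_succ, e0]
    linarith

/-! ### Monotone Boolean functions: influences and Russo's formula. -/

theorem diff_nonneg {f : (Fin n → Bool) → ℝ} (hf : Monotone f) (j : Fin n) (x : Fin n → Bool) :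
    0 ≤ diff j f x :=
  sub_nonneg.2 (hf (update_le_update_iff.2 ⟨by simp, fun _ _ => le_rfl⟩))

theorem diff_sq_of_zero_or_one {f : (Fin n → Bool) → ℝ} (hf : Monotone f)
    (h01 : ∀ x, f x = 0 ∨ f x = 1) (j : Fin n) (x : Fin n → Bool) :
    diff j f x ^ 2 = diff j f x := by
  have h := diff_nonneg hf j x
  unfold diff at *
  rcases h01 (Function.update x j true) with a | a <;>
    rcases h01 (Function.update x j false) with b | b <;> rw [a, b] at h ⊢ <;> first | (norm_num; done) | norm_num at h

/-- A monotone Boolean function of bounded total influence which is not almost constant has an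
influential coordinate. -/
theorem exists_influential_coordinate {v ε K : ℝ} (hv : 0 < v) (hε : 0 < ε) (hK : 0 < K) :
    ∃ η : ℝ, 0 < η ∧ ∀ (n : ℕ) (p : ℝ) (f : (Fin n → Bool) → ℝ), 0 ≤ p → p ≤ 1 →
      v ≤ p * (1 - p) → Monotone f → (∀ x, f x = 0 ∨ f x = 1) →
      ∑ j, mean p (diff j f) ≤ K → ε ≤ mean p f * (1 - mean p f) →
      ∃ j, η ≤ mean p (diff j f) := by
  -- If all influences are below `B⁻¹`, the sum of their squares is at most `B⁻¹ * K`, so the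
  -- variance inequality gives `m * ε ≤ 2 * K`; this `m` forbids it.
  obtain ⟨m, hm⟩ := exists_nat_gt (2 * K / ε)
  rw [div_lt_iff₀ hε] at hm
  set B : ℝ := (((v / 3)⁻¹) ^ (m + 1)) ^ 2 with hB
  have hB0 : 0 < B := by positivity
  refine ⟨B⁻¹, by positivity, fun n p f h0 h1 hvp hf h01 hI hV => ?_⟩
  by_contra! hη
  have h := mul_variance_le h0 h1 (show 0 < v / 3 by positivity) (by linarith) m f
  rw [← hB] at h
  have e1 : (fun x => f x ^ 2) = f := by
    funext x; rcases h01 x with a | a <;> simp [a]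
  have e2 : energy p f = ∑ j, mean p (diff j f) := by
    unfold energy
    simp only [diff_sq_of_zero_or_one hf h01]
  have e3 : ∑ j, mean p (fun x => |diff j f x|) ^ 2 ≤ B⁻¹ * K := by
    calc ∑ j, mean p (fun x => |diff j f x|) ^ 2
        = ∑ j, mean p (diff j f) * mean p (diff j f) := by
          simp only [abs_of_nonneg (diff_nonneg hf _ _), sq]
      _ ≤ ∑ j, B⁻¹ * mean p (diff j f) := Finset.sum_le_sum fun j _ =>
          mul_le_mul_of_nonneg_right (hη j).le (mean_nonneg h0 h1 (diff_nonneg hf j))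
      _ ≤ B⁻¹ * K := by
          rw [← Finset.mul_sum]
          gcongr
  rw [e1, e2] at h
  have e4 : B * ∑ j, mean p (fun x => |diff j f x|) ^ 2 ≤ K := by
    calc _ ≤ B * (B⁻¹ * K) := by gcongr
      _ = K := by field_simp
  have hm0 : (0 : ℝ) ≤ m := Nat.cast_nonneg m
  have e5 : p * (1 - p) * (∑ j, mean p (diff j f) + B * ∑ j, mean p (fun x => |diff j f x|) ^ 2) ≤
      1 * (K + K) := by
    have : p * (1 - p) ≤ 1 := by nlinarith
    refine mul_le_mul this (by linarith) (add_nonneg ?_ (by positivity)) (by norm_num)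
    exact Finset.sum_nonneg fun j _ => mean_nonneg h0 h1 (diff_nonneg hf j)
  have e6 : m * ε ≤ m * (mean p f - mean p f ^ 2) :=
    mul_le_mul_of_nonneg_left (by linarith) hm0
  linarith

/-- The Margulis–Russo formula. -/
theorem hasDerivAt_mean (f : (Fin n → Bool) → ℝ) (p : ℝ) :
    HasDerivAt (fun q => mean q f) (∑ j, mean p (diff j f)) p := by
  induction n with
  | zero => simpa [mean] using hasDerivAt_const p (f Fin.elim0)
  | succ n ih =>
    have h1 := (hasDerivAt_id p).mul (ih (fun x => f (Fin.cons true x)))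
    have h2 := ((hasDerivAt_const p (1 : ℝ)).sub (hasDerivAt_id p)).mul
      (ih (fun x => f (Fin.cons false x)))
    refine (h1.add h2).congr_deriv ?_
    have e0 : mean p (diff 0 f) =
        mean p (fun x => f (Fin.cons true x)) - mean p (fun x => f (Fin.cons false x)) := by
      rw [← mean_sub]
      simp only [mean, diff_zero_cons, headDiff]
      ring
    have es : ∀ j : Fin n, mean p (diff j.succ f) = p * mean p (diff j fun x => f (Fin.cons true x))
        + (1 - p) * mean p (diff j fun x => f (Fin.cons false x)) := by
      intro j
      simp only [mean, diff_succ_cons]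
    rw [Fin.sum_univ_succ, e0]
    simp only [es, Finset.sum_add_distrib, ← Finset.mul_sum, id, Pi.sub_apply]
    ring

theorem mean_mono {f : (Fin n → Bool) → ℝ} (hf : Monotone f) {q : ℝ} (h0 : 0 ≤ p) (hpq : p ≤ q)
    (h1 : q ≤ 1) : mean p f ≤ mean q f := by
  induction n with
  | zero => rfl
  | succ n ih =>
    have hc : ∀ b, Monotone fun x : Fin n → Bool => f (Fin.cons b x) := fun b x y hxy =>
      hf (Fin.cons_le_cons.2 ⟨le_rfl, hxy⟩)
    have a := ih (hc true)
    have b := ih (hc false)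
    have c : mean p (fun x => f (Fin.cons false x)) ≤ mean p (fun x => f (Fin.cons true x)) :=
      mean_le_mean h0 (hpq.trans h1) fun x => hf (Fin.cons_le_cons.2 ⟨Bool.false_le _, le_rfl⟩)
    simp only [mean]
    nlinarith

theorem mean_update_false (f : (Fin n → Bool) → ℝ) (j : Fin n) :
    mean p (fun x => f (Function.update x j false)) = mean p f - p * mean p (diff j f) := by
  induction n with
  | zero => exact j.elim0
  | succ n ih =>
    refine Fin.cases ?_ (fun j => ?_) j
    · simp only [mean, diff_zero_cons, Fin.update_cons_zero]
      unfold headDiff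
      rw [mean_sub]
      ring
    · simp only [mean, diff_succ_cons, ← Fin.cons_update]
      rw [ih j (f := fun x => f (Fin.cons true x)), ih j (f := fun x => f (Fin.cons false x))]
      change _ = _ - p * (p * mean p (diff j _) + (1 - p) * mean p (diff j _))
      ring

/-! ### Random partitions. -/

/-- If `g i` is small on average over the complements of the parts of any partition, then the
functions `g i` have small means. -/
theorem sum_mean_le_of_partition {r : ℕ} (hr : 0 < r) (g : Fin r → (Fin n → Bool) → ℝ) (C : ℝ)
    (h : ∀ y : Fin n → Fin r, ∑ i, g i (fun j => decide (y j ≠ i)) ≤ C) :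
    ∑ i, mean (1 - 1 / (r : ℝ)) (g i) ≤ C := by
  have hr0 : (0 : ℝ) < r := by exact_mod_cast hr
  induction n with
  | zero =>
    simp only [mean]
    convert h Fin.elim0 using 4
  | succ n ih =>
    set q := 1 - 1 / (r : ℝ) with hq
    have h' : ∀ a : Fin r, ∑ i, mean q (fun x => g i (Fin.cons (decide (a ≠ i)) x)) ≤ C := by
      intro a
      refine ih _ fun y => ?_
      refine le_of_eq_of_le ?_ (h (Fin.cons a y))
      refine Finset.sum_congr rfl fun i _ => congrArg (g i) ?_
      funext j
      refine Fin.cases ?_ (fun j => ?_) j <;> simp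
    have hs := Finset.sum_le_sum fun a (_ : a ∈ Finset.univ) => h' a
    rw [Finset.sum_comm] at hs
    -- Of the `r` parts available to the new point, only part `i` removes it from the complement of
    -- part `i`: this is the bias `1 - 1 / r`.
    have e : ∀ i, ∑ a : Fin r, mean q (fun x => g i (Fin.cons (decide (a ≠ i)) x)) =
        r * mean q (g i) := by
      intro i
      rw [← Finset.add_sum_erase _ _ (Finset.mem_univ i)]
      rw [Finset.sum_congr rfl (g := fun _ => mean q (fun x => g i (Fin.cons true x)))
        (fun a ha => by simp [Finset.ne_of_mem_erase ha])]
      rw [Finset.sum_const, Finset.card_erase_of_mem (Finset.mem_univ i), Finset.card_univ,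
        Fintype.card_fin, nsmul_eq_mul, Nat.cast_sub hr]
      simp only [mean, ne_eq, not_true_eq_false, decide_false]
      rw [hq]
      field_simp
      push_cast
      ring
    simp only [e, ← Finset.mul_sum, Finset.sum_const, Finset.card_univ, Fintype.card_fin,
      nsmul_eq_mul] at hs
    exact le_of_mul_le_mul_left hs hr0

theorem mean_le_of_no_partition {r : ℕ} (hr : 0 < r) {f : (Fin n → Bool) → ℝ}
    (h01 : ∀ x, f x = 0 ∨ f x = 1)
    (h : ∀ y : Fin n → Fin r, ∃ i, f (fun j => decide (y j ≠ i)) = 0) :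
    mean (1 - 1 / (r : ℝ)) f ≤ 1 - 1 / (r : ℝ) := by
  have hr0 : (0 : ℝ) < r := by exact_mod_cast hr
  have := sum_mean_le_of_partition hr (fun _ => f) (r - 1 : ℝ) fun y => by
    obtain ⟨i, hi⟩ := h y
    rw [← Finset.add_sum_erase _ _ (Finset.mem_univ i), hi, zero_add]
    refine (Finset.sum_le_card_nsmul _ _ 1 fun a _ => ?_).trans ?_
    · rcases h01 (fun j => decide (y j ≠ a)) with h | h <;> rw [h]; norm_num
    · rw [Finset.card_erase_of_mem (Finset.mem_univ i), Finset.card_univ, Fintype.card_fin,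
        nsmul_eq_mul, Nat.cast_sub hr]
      simp
  simp only [Finset.sum_const, Finset.card_univ, Fintype.card_fin, nsmul_eq_mul] at this
  rw [← mul_le_mul_iff_right₀ hr0]
  refine this.trans (le_of_eq ?_)
  field_simp

/-! ### Concentration of the weight. -/

/-- The number of coordinates of `x` which are `true`. -/
def weight (x : Fin n → Bool) : ℝ := ∑ j, if x j then 1 else 0

theorem weight_cons (b : Bool) (x : Fin n → Bool) :
    weight (Fin.cons b x : Fin (n + 1) → Bool) = (if b then 1 else 0) + weight x := by
  rw [weight, Fin.sum_univ_succ]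
  simp only [Fin.cons_zero, Fin.cons_succ]
  rfl

theorem mean_weight_sub_sq :
    mean p (fun x : Fin n → Bool => (weight x - n * p) ^ 2) = n * (p * (1 - p)) := by
  induction n with
  | zero => simp [mean, weight]
  | succ n ih =>
    have e : headMean p (fun x : Fin (n + 1) → Bool => (weight x - (n + 1 : ℕ) * p) ^ 2) =
        fun x => (weight x - n * p) ^ 2 + p * (1 - p) := by
      funext x
      simp only [headMean, weight_cons]
      push_cast
      norm_num
      ring
    rw [mean_succ, e, mean_add, ih, mean_const]
    push_cast
    ring

/-- A lower bound for the mean of a function which is at least `1` on all points of large weight. -/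
theorem one_sub_le_mean (h0 : 0 ≤ p) (h1 : p ≤ 1) {d : ℝ} (hd : 0 < d)
    {f : (Fin n → Bool) → ℝ} (hf0 : ∀ x, 0 ≤ f x)
    (hf : ∀ x, n * p - d ≤ weight x → 1 ≤ f x) :
    1 - n / d ^ 2 ≤ mean p f := by
  -- Chebyshev's inequality, through a quadratic minorant of `f`.
  have h := mean_le_mean h0 h1 (f := fun x => 1 - (1 / d ^ 2) * (weight x - n * p) ^ 2) (g := f)
    fun x => ?_
  · rw [mean_sub, mean_const, mean_const_mul, mean_weight_sub_sq] at h
    refine le_trans ?_ h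
    have : (n : ℝ) * (p * (1 - p)) ≤ n * 1 :=
      mul_le_mul_of_nonneg_left (by nlinarith) (Nat.cast_nonneg n)
    have := mul_le_mul_of_nonneg_left this (show 0 ≤ 1 / d ^ 2 by positivity)
    have e : (n : ℝ) / d ^ 2 = 1 / d ^ 2 * (n * 1) := by ring
    rw [e]
    linarith
  · by_cases hx : n * p - d ≤ weight x
    · have : 0 ≤ 1 / d ^ 2 * (weight x - n * p) ^ 2 := by positivity
      linarith [hf x hx]
    · push Not at hx
      have : d ^ 2 ≤ (weight x - n * p) ^ 2 := by nlinarith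
      have : 1 ≤ 1 / d ^ 2 * (weight x - n * p) ^ 2 := by
        rw [one_div, inv_mul_eq_div, le_div_iff₀ (by positivity)]
        linarith
      linarith [hf0 x]

/-! ### Setting influential coordinates to `false`. -/

/-- The function obtained from `f` by setting the coordinates in `J` to `false`. -/
def restrict (J : Finset (Fin n)) (f : (Fin n → Bool) → ℝ) (x : Fin n → Bool) : ℝ :=
  f (fun j => x j && decide (j ∉ J))

theorem restrict_insert (J : Finset (Fin n)) (j : Fin n) (f : (Fin n → Bool) → ℝ) :
    restrict (insert j J) f = fun x => restrict J f (Function.update x j false) := by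
  funext x
  refine congrArg f (funext fun i => ?_)
  by_cases h : i = j
  · subst h; simp
  · simp [h]

theorem restrict_monotone (J : Finset (Fin n)) {f : (Fin n → Bool) → ℝ} (hf : Monotone f) :
    Monotone (restrict J f) := fun x y hxy => hf fun j => by
  have h := Bool.le_iff_imp.1 (hxy j)
  rw [Bool.le_iff_imp]
  simp only [Bool.and_eq_true]
  exact fun ⟨hx, hj⟩ => ⟨h hx, hj⟩

theorem restrict_le (J : Finset (Fin n)) {f : (Fin n → Bool) → ℝ} (hf : Monotone f)
    (x : Fin n → Bool) : restrict J f x ≤ f x := hf fun j => by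
  cases x j <;> simp

theorem exists_half_le_of_half_le_sum {t : ℕ} {a : Fin t → ℝ} (h : 1 / 2 ≤ ∑ i, a i) :
    ∃ i, 1 / (2 * ((t : ℝ) + 1)) ≤ a i := by
  by_contra! hlt
  have h1 := Finset.sum_le_sum fun i (_ : i ∈ Finset.univ) => (hlt i).le
  rw [Finset.sum_const, Finset.card_univ, Fintype.card_fin, nsmul_eq_mul] at h1
  have h2 : (t : ℝ) * (1 / (2 * ((t : ℝ) + 1))) < 1 / 2 := by
    rw [mul_one_div, div_lt_div_iff₀ (by positivity) (by norm_num)]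
    linarith
  linarith

/-- Monotone Boolean functions, finitely many of them, whose means stay away from `1` become small
on the whole after a bounded number of coordinates is set to `false`. -/
theorem exists_restrict_sum_mean_lt (t : ℕ) {p₀ p₁ ε : ℝ} (hp₀ : 0 < p₀) (hp : p₀ < p₁)
    (hp₁ : p₁ < 1) (hε : 0 < ε) :
    ∃ M : ℕ, ∀ (n : ℕ) (f : Fin t → (Fin n → Bool) → ℝ), (∀ i, Monotone (f i)) →
      (∀ i x, f i x = 0 ∨ f i x = 1) → (∀ i, mean p₁ (f i) ≤ 1 - ε) →
      ∃ J : Finset (Fin n), J.card ≤ M ∧ ∃ q, p₀ ≤ q ∧ q ≤ p₁ ∧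
        ∑ i, mean q (restrict J (f i)) < 1 / 2 := by
  have hd : 0 < p₁ - p₀ := sub_pos.2 hp
  obtain ⟨η, hη, hinf⟩ := exists_influential_coordinate (v := p₀ * (1 - p₁))
    (ε := 1 / (2 * ((t : ℝ) + 1)) * ε) (K := (t + 1) / (p₁ - p₀))
    (mul_pos hp₀ (by linarith)) (by positivity) (by positivity)
  -- There are `M` steps, each lowering the bias by `δ` and the sum by at least `β`. This size of
  -- `M` makes `β ≤ p₀ * η`, the drop that one influential coordinate guarantees.
  obtain ⟨M, hM⟩ := exists_nat_gt ((t + 1) / (p₀ * η))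
  have hM0 : (0 : ℝ) < M := lt_of_le_of_lt (by positivity) hM
  refine ⟨M, fun n f hf h01 hf1 => ?_⟩
  by_contra! hbig
  set δ := (p₁ - p₀) / M with hδ
  set β := ((t : ℝ) + 1) / M with hβ
  have hδ0 : 0 < δ := by positivity
  have hδM : M * δ = p₁ - p₀ := by rw [hδ]; field_simp
  have hβη : β ≤ p₀ * η := by
    rw [div_lt_iff₀ (by positivity)] at hM
    rw [hβ, div_le_iff₀ hM0]
    linarith
  have key : ∀ i : ℕ, i ≤ M → ∃ J : Finset (Fin n), J.card ≤ i ∧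
      ∑ a, mean (p₁ - i * δ) (restrict J (f a)) ≤ t - i * β := by
    intro i
    induction i with
    | zero =>
      intro _
      refine ⟨∅, by simp, ?_⟩
      simp only [Nat.cast_zero, zero_mul, sub_zero]
      refine (Finset.sum_le_card_nsmul _ _ 1 fun a _ => ?_).trans (by simp)
      refine (mean_le_mean (by linarith) hp₁.le (g := f a) fun x => restrict_le _ (hf a) x).trans ?_
      linarith [hf1 a]
    | succ i ih =>
      intro hi
      obtain ⟨J, hJ, hJs⟩ := ih (by omega)
      have hi' : ((i : ℝ) + 1) * δ ≤ p₁ - p₀ := by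
        rw [← hδM]
        gcongr
        exact_mod_cast hi
      have hiδ : 0 ≤ (i : ℝ) * δ := by positivity
      push_cast
      obtain ⟨b, hb⟩ : ∃ b, b = p₁ - i * δ := ⟨_, rfl⟩
      have ha : p₁ - (i + 1) * δ = b - δ := by rw [hb]; ring
      rw [← hb] at hJs
      rw [ha]
      by_cases hdrop : ∑ a, mean (b - δ) (restrict J (f a)) ≤ t - (i + 1) * β
      · exact ⟨J, by omega, hdrop⟩
      push Not at hdrop
      have hderiv : ∀ q, HasDerivAt (fun q => ∑ a, mean q (restrict J (f a)))
          (∑ a, ∑ j, mean q (diff j (restrict J (f a)))) q := fun q =>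
        HasDerivAt.fun_sum fun a _ => hasDerivAt_mean _ _
      -- When lowering the bias alone does not suffice, the mean value theorem gives a bias with
      -- total influence at most `β / δ = (t + 1) / (p₁ - p₀)`.
      obtain ⟨q, hq, hqs⟩ := exists_hasDerivAt_eq_slope _ _ (show b - δ < b by linarith)
        (fun q _ => (hderiv q).continuousAt.continuousWithinAt) (fun q _ => hderiv q)
      have hq0 : p₀ ≤ q := by linarith [hq.1]
      have hq1 : q ≤ p₁ := by linarith [hq.2]
      have hq0' : 0 ≤ q := hp₀.le.trans hq0
      have hq1' : q ≤ 1 := hq1.trans hp₁.le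
      have hm : ∀ a, Monotone (restrict J (f a)) := fun a => restrict_monotone J (hf a)
      have hnn : ∀ a j, 0 ≤ mean q (diff j (restrict J (f a))) := fun a j =>
        mean_nonneg hq0' hq1' (diff_nonneg (hm a) j)
      have hslope : ∑ a, ∑ j, mean q (diff j (restrict J (f a))) ≤ (t + 1) / (p₁ - p₀) := by
        rw [hqs, sub_sub_cancel, div_le_iff₀ hδ0]
        have : ((t : ℝ) + 1) / (p₁ - p₀) * δ = β := by rw [hδ, hβ]; field_simp
        rw [this]
        linarith
      obtain ⟨a, ha2⟩ := exists_half_le_of_half_le_sum (hbig J (by omega) q hq0 hq1)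
      have ha1 : ε ≤ 1 - mean q (restrict J (f a)) := by
        have h1 := mean_le_mean hq0' hq1' (restrict_le J (hf a))
        have h2 := mean_mono (hf a) hq0' hq1 hp₁.le
        linarith [hf1 a]
      obtain ⟨j, hj⟩ := hinf n q (restrict J (f a)) hq0' hq1'
        (mul_le_mul hq0 (by linarith) (by linarith) hq0') (hm a) (fun x => h01 a _)
        ((Finset.single_le_sum (f := fun a => ∑ j, mean q (diff j (restrict J (f a))))
          (fun a _ => Finset.sum_nonneg fun j _ => hnn a j) (Finset.mem_univ a)).trans hslope)
        (mul_le_mul ha2 ha1 hε.le (le_trans (by positivity) ha2))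
      refine ⟨insert j J, (Finset.card_insert_le _ _).trans (by omega), ?_⟩
      have s1 : ∑ a, mean (b - δ) (restrict (insert j J) (f a)) ≤
          ∑ a, mean q (restrict (insert j J) (f a)) := Finset.sum_le_sum fun a _ =>
        mean_mono (restrict_monotone _ (hf a)) (by linarith) hq.1.le hq1'
      have s2 : ∑ a, mean q (restrict (insert j J) (f a)) =
          ∑ a, mean q (restrict J (f a)) - q * ∑ a, mean q (diff j (restrict J (f a))) := by
        simp only [restrict_insert, mean_update_false, Finset.sum_sub_distrib, Finset.mul_sum]
      have s3 : ∑ a, mean q (restrict J (f a)) ≤ ∑ a, mean b (restrict J (f a)) :=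
        Finset.sum_le_sum fun a _ => mean_mono (hm a) hq0' hq.2.le (by linarith)
      have s4 : η ≤ ∑ a, mean q (diff j (restrict J (f a))) :=
        hj.trans (Finset.single_le_sum (f := fun a => mean q (diff j (restrict J (f a))))
          (fun a _ => hnn a j) (Finset.mem_univ a))
      have s5 : p₀ * η ≤ q * ∑ a, mean q (diff j (restrict J (f a))) :=
        mul_le_mul hq0 s4 hη.le hq0'
      linarith
  -- After `M` steps the bound is `t - (t + 1) = -1`, against `hbig`.
  obtain ⟨J, hJ, hJs⟩ := key M le_rfl
  rw [hδM, sub_sub_cancel, show M * β = (t : ℝ) + 1 by rw [hβ]; field_simp] at hJs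
  linarith [hbig J hJ p₀ le_rfl hp.le]

/-! ### Families of `k`-sets and their up-closures. -/

open Classical in
/-- The indicator function of the up-closure of a family of sets. -/
noncomputable def upIndicator (C : Finset (Finset (Fin n))) (x : Fin n → Bool) : ℝ :=
  if ∃ A ∈ C, ∀ j ∈ A, x j = true then 1 else 0

theorem upIndicator_zero_or_one (C : Finset (Finset (Fin n))) (x : Fin n → Bool) :
    upIndicator C x = 0 ∨ upIndicator C x = 1 := by
  unfold upIndicator
  split_ifs <;> simp

theorem upIndicator_monotone (C : Finset (Finset (Fin n))) : Monotone (upIndicator C) := by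
  intro x y hxy
  unfold upIndicator
  split_ifs with h1 h2 h2
  · rfl
  · obtain ⟨A, hA, h⟩ := h1
    exact absurd ⟨A, hA, fun j hj => Bool.le_iff_imp.1 (hxy j) (h j hj)⟩ h2
  · norm_num
  · rfl

/-- A large family in which any `r` distinct sets have a common element has an up-closure of small
measure. -/
theorem mean_upIndicator_le {r : ℕ} (hr : 0 < r) (C : Finset (Finset (Fin n)))
    (hC : r ≤ C.card) (h : ∀ S ⊆ C, S.card = r → ∃ x, ∀ A ∈ S, x ∈ A) :
    mean (1 - 1 / (r : ℝ)) (upIndicator C) ≤ 1 - 1 / (r : ℝ) := by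
  classical
  refine mean_le_of_no_partition hr (upIndicator_zero_or_one C) fun y => ?_
  by_contra! hy
  have hA : ∀ i, ∃ A ∈ C, ∀ j ∈ A, y j ≠ i := by
    intro i
    by_contra hi
    refine hy i (if_neg ?_)
    simpa using hi
  choose A hAC hA using hA
  -- The sets `A i` may coincide; they are padded to `r` distinct members of `C`, which is why `C`
  -- needs at least `r` members. A common point `x` would lie in `A (y x)`, which avoids it.
  obtain ⟨S, hS1, hS2, hS⟩ := Finset.exists_subsuperset_card_eq
    (s := Finset.univ.image A) (t := C) (n := r)
    (by intro B hB; obtain ⟨i, -, rfl⟩ := Finset.mem_image.1 hB; exact hAC i)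
    (Finset.card_image_le.trans (by simp)) hC
  obtain ⟨x, hx⟩ := h S hS2 hS
  exact hA (y x) x (hx _ (hS1 (Finset.mem_image_of_mem _ (Finset.mem_univ _)))) rfl

/-- A bounded number of points meets every set of every small family. -/
theorem exists_transversal_of_small {r t k : ℕ} (hk : 0 < k)
    (C : Fin t → Finset (Finset (Fin n))) (hCk : ∀ i, ∀ A ∈ C i, A.card = k) :
    ∃ J : Finset (Fin n), J.card ≤ t * r ∧
      ∀ i, (C i).card < r → ∀ A ∈ C i, ∃ x ∈ A, x ∈ J := by
  classical
  have hx : ∀ A : {A : Finset (Fin n) // A.Nonempty}, ∃ x, x ∈ A.1 := fun A => A.2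
  choose e he using hx
  refine ⟨(Finset.univ.filter fun i => (C i).card < r).biUnion fun i =>
    (C i).attach.image fun A => e ⟨A.1, Finset.card_pos.1 (by rw [hCk i _ A.2]; exact hk)⟩, ?_, ?_⟩
  · refine (Finset.card_biUnion_le_card_mul _ _ r fun i hi => ?_).trans
      (Nat.mul_le_mul_right r ((Finset.card_filter_le _ _).trans (by simp)))
    refine Finset.card_image_le.trans ?_
    rw [Finset.card_attach]
    exact (Finset.mem_filter.1 hi).2.le
  · intro i hi A hA
    refine ⟨_, he ⟨A, Finset.card_pos.1 (by rw [hCk i A hA]; exact hk)⟩, ?_⟩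
    exact Finset.mem_biUnion.2 ⟨i, by simpa using hi,
      Finset.mem_image.2 ⟨⟨A, hA⟩, Finset.mem_attach _ _, rfl⟩⟩

/-- A point of weight at least `k + M` still has `k` true coordinates outside `J₀ ∪ J`. The class of
such a `k`-set cannot be small, since `J₀` misses the set, so its restricted indicator equals `1`.
-/
theorem one_le_sum_restrict {r t k M : ℕ} (C : Fin t → Finset (Finset (Fin n)))
    (hcover : ∀ A : Finset (Fin n), A.card = k → ∃ i, A ∈ C i) {J₀ J : Finset (Fin n)}
    (hJ₀ : ∀ i, (C i).card < r → ∀ A ∈ C i, ∃ x ∈ A, x ∈ J₀)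
    (hM : J₀.card + J.card ≤ M) (f : Fin t → (Fin n → Bool) → ℝ) (hf0 : ∀ i x, 0 ≤ f i x)
    (hf : ∀ i, r ≤ (C i).card → f i = restrict J₀ (upIndicator (C i))) (x : Fin n → Bool)
    (hx : ((k + M : ℕ) : ℝ) ≤ weight x) :
    1 ≤ ∑ i, restrict J (f i) x := by
  classical
  have hw : weight x = ((Finset.univ.filter fun j => x j = true).card : ℝ) := by
    simp [weight]
  rw [hw, Nat.cast_le] at hx
  have h1 := Finset.le_card_sdiff (J₀ ∪ J) (Finset.univ.filter fun j => x j = true)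
  have h2 := Finset.card_union_le J₀ J
  obtain ⟨A, hA, hAk⟩ := Finset.exists_subset_card_eq
    (s := (Finset.univ.filter fun j => x j = true) \ (J₀ ∪ J)) (n := k) (by omega)
  have hA' : ∀ j ∈ A, x j = true ∧ j ∉ J₀ ∧ j ∉ J := fun j hj => by
    simpa using hA hj
  obtain ⟨i, hi⟩ := hcover A hAk
  have hr : r ≤ (C i).card := by
    by_contra hlt
    obtain ⟨y, hy, hy'⟩ := hJ₀ i (by omega) A hi
    exact (hA' y hy).2.1 hy'
  have h3 : restrict J (f i) x = 1 := by
    rw [hf i hr]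
    refine if_pos ⟨A, hi, fun j hj => ?_⟩
    obtain ⟨a, b, c⟩ := hA' j hj
    simp [a, b, c]
  rw [← h3]
  exact Finset.single_le_sum (f := fun i => restrict J (f i) x) (fun i _ => hf0 i _)
    (Finset.mem_univ i)

/-- If the `k`-element subsets of an `n`-element set, where `n` is about `D * k` and `D` exceeds
`r / (r - 1)`, are covered by boundedly many families, then one of the families contains `r`
distinct sets without a common element. -/
theorem exists_empty_inter_of_cover (r t : ℕ) (hr : 2 ≤ r) {D : ℝ}
    (hD : 1 < D * (1 - 1 / (r : ℝ))) :
    ∃ K₀ : ℕ, 0 < K₀ ∧ ∀ k n : ℕ, K₀ ≤ k → D * k - 1 ≤ n → (n : ℝ) ≤ D * k + 1 →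
      ∀ C : Fin t → Finset (Finset (Fin n)), (∀ i, ∀ A ∈ C i, A.card = k) →
        (∀ A : Finset (Fin n), A.card = k → ∃ i, A ∈ C i) →
        ∃ i, ∃ S ⊆ C i, S.card = r ∧ ∀ x, ∃ A ∈ S, x ∉ A := by
  have hr2 : (2 : ℝ) ≤ r := by exact_mod_cast hr
  have hr0 : (0 : ℝ) < 1 / r := by positivity
  have hr1 : 1 / (r : ℝ) ≤ 1 / 2 := one_div_le_one_div_of_le (by norm_num) hr2
  set p₁ := 1 - 1 / (r : ℝ) with hp₁
  have hD0 : 0 < D := by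
    by_contra hD0
    nlinarith
  have hD1 : 1 / D < p₁ := by rw [div_lt_iff₀ hD0]; linarith
  obtain ⟨p₀, hp0, hp01⟩ := exists_between hD1
  have hp₀ : 0 < p₀ := lt_trans (by positivity) hp0
  rw [div_lt_iff₀ hD0] at hp0
  obtain ⟨γ, hγ⟩ : ∃ γ, γ = p₀ * D - 1 := ⟨_, rfl⟩
  have hγ0 : 0 < γ := by linarith
  obtain ⟨M, hM⟩ := exists_restrict_sum_mean_lt t hp₀ hp01 (by linarith) hr0
  -- `K₁` makes the surplus `d` of the expected weight over `k + t * r + M` at least `γ * k / 2`;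
  -- `K₂` then makes the Chebyshev error `n / d ^ 2` at most `1 / 2`.
  obtain ⟨K₁, hK₁⟩ := exists_nat_gt (2 * ((t * r + M : ℕ) + 1) / γ)
  obtain ⟨K₂, hK₂⟩ := exists_nat_gt (8 * (D + 1) / γ ^ 2)
  refine ⟨K₁ + K₂ + 1, by omega, fun k n hk hn hn' C hCk hcover => ?_⟩
  by_contra! hS
  have hk' : (K₁ : ℝ) + K₂ + 1 ≤ k := by exact_mod_cast hk
  have hK₁0 : (0 : ℝ) ≤ K₁ := Nat.cast_nonneg _
  have hK₂0 : (0 : ℝ) ≤ K₂ := Nat.cast_nonneg _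
  rw [div_lt_iff₀ hγ0] at hK₁
  rw [div_lt_iff₀ (by positivity)] at hK₂
  obtain ⟨J₀, hJ₀, hJ₀C⟩ := exists_transversal_of_small (r := r) (by omega) C hCk
  classical
  set f : Fin t → (Fin n → Bool) → ℝ := fun i =>
    if r ≤ (C i).card then restrict J₀ (upIndicator (C i)) else fun _ => 0 with hf
  have hf01 : ∀ i x, f i x = 0 ∨ f i x = 1 := by
    intro i x
    by_cases h : r ≤ (C i).card
    · simp only [hf, if_pos h]; exact upIndicator_zero_or_one _ _
    · simp only [hf, if_neg h]; simp
  have hf0 : ∀ i x, 0 ≤ f i x := fun i x => by rcases hf01 i x with h | h <;> rw [h]; norm_num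
  obtain ⟨J, hJ, q, hq0, hq1, hlt⟩ := hM n f
    (fun i => by
      by_cases h : r ≤ (C i).card
      · simp only [hf, if_pos h]; exact restrict_monotone _ (upIndicator_monotone _)
      · simp only [hf, if_neg h]; exact monotone_const)
    hf01
    (fun i => by
      by_cases h : r ≤ (C i).card
      · simp only [hf, if_pos h]
        refine (mean_le_mean (by linarith) (by linarith)
          (restrict_le J₀ (upIndicator_monotone (C i)))).trans ?_
        exact mean_upIndicator_le (by omega) (C i) h (hS i)
      · simp only [hf, if_neg h, mean_const]; linarith)
  have hN : n * q - (n * q - ((k + (t * r + M) : ℕ) : ℝ)) = ((k + (t * r + M) : ℕ) : ℝ) := by ring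
  have hnq : n * p₀ ≤ n * q := by gcongr
  have hnp : (D * k - 1) * p₀ ≤ n * p₀ := by gcongr
  have hk0 : (0 : ℝ) < k := by linarith
  have hd : γ / 2 * k ≤ n * q - ((k + (t * r + M) : ℕ) : ℝ) := by
    have h1 : (D * k - 1) * p₀ = (γ + 1) * k - p₀ := by rw [hγ]; ring
    have h2 : K₁ * γ ≤ k * γ := by gcongr; linarith
    push_cast at hK₁ ⊢
    nlinarith
  set d := n * q - ((k + (t * r + M) : ℕ) : ℝ) with hd_def
  have hd0 : 0 < d := lt_of_lt_of_le (by positivity) hd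
  have hmean := one_sub_le_mean (n := n) (p := q) (by linarith) (by linarith) hd0
    (f := fun x => ∑ i, restrict J (f i) x) (fun x => Finset.sum_nonneg fun i _ => hf0 i _)
    (fun x hx => one_le_sum_restrict (M := t * r + M) C hcover hJ₀C (by omega) f hf0
      (fun i h => by simp only [hf, if_pos h]) x (by rw [← hN]; exact hx))
  rw [mean_sum] at hmean
  have hnd : n / d ^ 2 ≤ 1 / 2 := by
    have h1 : (γ / 2 * k) ^ 2 ≤ d ^ 2 := by gcongr
    have h2 : K₂ * γ ^ 2 ≤ k * γ ^ 2 := by gcongr; linarith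
    have h3 : 8 * (D + 1) * k ≤ k * γ ^ 2 * k :=
      mul_le_mul_of_nonneg_right (by linarith) hk0.le
    rw [div_le_div_iff₀ (by positivity) (by norm_num)]
    nlinarith
  linarith

end BiasedCube

/-! ### Back to colourings. -/

namespace Hypergraph

theorem not_colorable_generalizedKneser {r s n k t : ℕ} (hs : r ≤ s + 1)
    (h : ∀ C : Fin t → Finset (Finset (Fin n)), (∀ i, ∀ A ∈ C i, A.card = k) →
      (∀ A : Finset (Fin n), A.card = k → ∃ i, A ∈ C i) →
      ∃ i, ∃ S ⊆ C i, S.card = r ∧ ∀ x, ∃ A ∈ S, x ∉ A) :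
    ¬ (generalizedKneser r s n k).Colorable t := by
  classical
  rintro ⟨f, hf⟩
  obtain ⟨i, S, hSC, hSr, hS⟩ := h
    (fun i => Finset.univ.filter fun A => ∃ hA : A.card = k, f ⟨A, hA⟩ = i)
    (fun i A hA => (Finset.mem_filter.1 hA).2.1)
    (fun A hA => ⟨f ⟨A, hA⟩, Finset.mem_filter.2 ⟨Finset.mem_univ _, hA, rfl⟩⟩)
  have hmem : ∀ A ∈ S, ∃ hA : A.card = k, f ⟨A, hA⟩ = i := fun A hA =>
    (Finset.mem_filter.1 (hSC hA)).2
  have hedge : (S : Set (Finset (Fin n))) ∈ (generalizedKneser r s n k).edgeSet := by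
    refine ⟨fun A hA => (hmem A hA).1, by rw [Set.encard_coe_eq_coe_finsetCard, hSr], fun x => ?_⟩
    obtain ⟨A, hA, hxA⟩ := hS x
    -- Every point is missed by some member of `S`, hence lies in at most `r - 1 ≤ s` of them.
    have hsub : {F | F ∈ (S : Set (Finset (Fin n))) ∧ x ∈ F} ⊆ (S.erase A : Finset _) := by
      rintro F ⟨hF, hxF⟩
      exact Finset.mem_coe.2 (Finset.mem_erase.2 ⟨fun e => hxA (e ▸ hxF), hF⟩)
    refine (Set.encard_le_encard hsub).trans ?_
    rw [Set.encard_coe_eq_coe_finsetCard, Finset.card_erase_of_mem hA, hSr]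
    exact_mod_cast (by omega : r - 1 ≤ s)
  obtain ⟨u, v, hu, hv, huv⟩ := hf _ hedge
  obtain ⟨_, hu'⟩ := hmem u hu
  obtain ⟨_, hv'⟩ := hmem v hv
  exact huv (hu'.trans hv'.symm)

theorem Colorable.mono {α : Type*} {H : Hypergraph α} {m t : ℕ} (hmt : m ≤ t)
    (h : H.Colorable m) : H.Colorable t := by
  obtain ⟨f, hf⟩ := h
  refine ⟨fun v => Fin.castLE hmt (f v), fun e he => ?_⟩
  obtain ⟨u, v, hu, hv, huv⟩ := hf e he
  exact ⟨u, v, hu, hv, fun h => huv (Fin.castLE_injective hmt h)⟩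

theorem lt_chromaticNumber_of_not_colorable {α : Type*} {H : Hypergraph α} {t : ℕ}
    (h : ¬ H.Colorable t) : (t : ℕ∞) < H.chromaticNumber := by
  refine lt_of_lt_of_le (b := ((t + 1 : ℕ) : ℕ∞)) (by exact_mod_cast t.lt_succ_self) ?_
  refine le_iInf₂ fun m hm => ?_
  by_contra hlt
  have hlt' : m < t + 1 := by exact_mod_cast not_le.1 hlt
  exact h (hm.mono (by omega))

end Hypergraph

theorem mainTheorem7 (c : ℝ) (hc : 0 < c) (r t : ℕ) (hr : 2 ≤ r) :
    ∃ K₀ : ℕ, ∀ k s n : ℕ, K₀ ≤ k → s = r - 1 →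
      (n = ⌊((r : ℝ) / (s : ℝ) + c) * (k : ℝ)⌋₊ ∨ n = ⌈((r : ℝ) / (s : ℝ) + c) * (k : ℝ)⌉₊) →
      (t : ℕ∞) < (Hypergraph.generalizedKneser r s n k).chromaticNumber := by
  have hr2 : (2 : ℝ) ≤ r := by exact_mod_cast hr
  have hs0 : (0 : ℝ) < r - 1 := by linarith
  obtain ⟨K₀, -, hK₀⟩ := BiasedCube.exists_empty_inter_of_cover r t hr (D := r / (r - 1) + c) (by
    -- The excess `c * (r - 1) / r` over `1` is the room between `1 / D` and `1 - 1 / r`.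
    have : ((r : ℝ) / (r - 1) + c) * (1 - 1 / r) = 1 + c * ((r - 1) / r) := by field_simp
    rw [this]
    have : 0 < c * ((r - 1) / (r : ℝ)) := by positivity
    linarith)
  refine ⟨K₀, fun k s n hk hs hn => ?_⟩
  subst hs
  rw [Nat.cast_sub (by omega : 1 ≤ r), Nat.cast_one] at hn
  have hx0 : 0 ≤ ((r : ℝ) / (r - 1) + c) * k := by positivity
  have h1 := Nat.floor_le hx0
  have h2 := Nat.lt_floor_add_one (((r : ℝ) / (r - 1) + c) * k)
  have h3 := Nat.le_ceil (((r : ℝ) / (r - 1) + c) * k)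
  have h4 := Nat.ceil_lt_add_one hx0
  refine Hypergraph.lt_chromaticNumber_of_not_colorable
    (Hypergraph.not_colorable_generalizedKneser (by omega) (hK₀ k n hk ?_ ?_))
  · rcases hn with rfl | rfl <;> linarith
  · rcases hn with rfl | rfl <;> linarith
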